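/- Let $X_1$ be a real random variable with $\mathbb E[X_1^{16}]<\infty$, and let $(X_n)_{n\ge 1}$ be the first-order random coefficient bifurcating autoregressive process defined, for all $n\ge 1$, by $$X_{2n}=a_nX_n+\varepsilon_{2n},\qquad X_{2n+1}=b_nX_n+\varepsilon_{2n+1},$$ where $((a_n,b_n))_{n\ge1}$ and $((\varepsilon_{2n},\varepsilon_{2n+1}))_{n\ge1}$ are two sequences of independent and identically distributed random pairs, independent of each other. Let $\mathbb T_n=\{1,2,\dots,2^{n+1}-1\}$ be the set of individuals of the binary tree up to generation $n$, so that $|\mathbb T_n|=2^{n+1}-1$. Assume (H.1) for all $n\ge1$, $\mathbb E[a_n^{16}]<1$ and $\mathbb E[b_n^{16}]<1$, and moreover $\sup_{n\ge1}\mathbb E[\varepsilon_{2n}^{16}]<\infty$ and $\sup_{n\ge1}\mathbb E[\varepsilon_{2n+1}^{16}]<\infty$. For $1\le p\le 8$ put $A_p=\mathbb E[a_1^p]$, $B_p=\mathbb E[b_1^p]$, $C_p=\mathbb E[\varepsilon_2^p]$, $D_p=\mathbb E[\varepsilon_3^p]$. Then these moments are finite, $A_p+B_p<2$, and for each $p\in\{1,\dots,8\}$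 $$\lim_{n\to\infty}\frac1{|\mathbb T_n|}\sum_{k\in\mathbb T_n}X_k^p=s_p\qquad\text{almost surely},$$ where $s_p$ is a constant that depends only on the moments of $a_1$, $b_1$, $\varepsilon_2$, $\varepsilon_3$ up to order $p$ (that is, $s_p$ is a function, the same for all such processes, of $(A_k,B_k,C_k,D_k)_{1\le k\le p}$). Writing $a,b,c,d$ for the means and $\sigma_a^2,\sigma_b^2,\sigma_c^2,\sigma_d^2$ for the variances of $a_1,b_1,\varepsilon_2,\varepsilon_3$, $$s_1=\frac{c+d}{2-(a+b)},$$ $$s_2=\frac{2}{2-(\sigma_a^2+\sigma_b^2+a^2+b^2)}\left(\frac{(ac+bd)(c+d)}{2-(a+b)}+\frac{\sigma_c^2+\sigma_d^2+c^2+d^2}{2}\right),$$ and for every $p\in\{1,\dots,8\}$ the linear recursion $$s_p=\frac{2}{2-(A_p+B_p)}\left(\sum_{k=1}^{p-1}\frac12\binom pk\left(A_kC_{p-k}+B_kD_{p-k}\right)s_k+\frac{C_p+D_p}{2}\right)$$ holds. -/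

import Mathlib

open MeasureTheory ProbabilityTheory Filter Topology

/-- The `n`-th generation `{2^n, 2^n + 1, …, 2^(n+1) - 1}` of the binary tree. -/
def generation (n : ℕ) : Finset ℕ := Finset.Ico (2 ^ n) (2 ^ (n + 1))

/-- The set of all individuals of the binary tree up to the `n`-th generation. -/
def treeUpTo (n : ℕ) : Finset ℕ := (Finset.range (n + 1)).biUnion generation

/-- `X` is a first-order random coefficient bifurcating autoregressive (RCBAR) process with
random coefficients `(a n, b n)` and driven noise `(ε (2 * n), ε (2 * n + 1))`, `n ≥ 1`.
Only the indices `n ≥ 1` of `X`, `a`, `b` and `n ≥ 2` of `ε` matter. The two coordinates of a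
pair may be dependent, and nothing is assumed on the joint law of the ancestor `X 1` and
the two sequences. -/
structure IsRCBAR {Ω : Type*} [MeasurableSpace Ω] (μ : Measure Ω)
    (X a b ε : ℕ → Ω → ℝ) : Prop where
  measurable_ancestor : Measurable (X 1)
  measurable_a : ∀ n, 1 ≤ n → Measurable (a n)
  measurable_b : ∀ n, 1 ≤ n → Measurable (b n)
  measurable_noise : ∀ n, 2 ≤ n → Measurable (ε n)
  /-- The ancestor has a finite moment of order 16. -/
  integrable_ancestor : Integrable (fun ω => X 1 ω ^ 16) μ
  /-- The pairs `(a n, b n)`, `n ≥ 1`, are independent ... -/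
  indep_coeff : iIndepFun (fun (n : ℕ) (ω : Ω) => (a (n + 1) ω, b (n + 1) ω)) μ
  /-- ... and identically distributed. -/
  ident_coeff : ∀ n, 1 ≤ n →
    IdentDistrib (fun ω => (a n ω, b n ω)) (fun ω => (a 1 ω, b 1 ω)) μ μ
  /-- The pairs `(ε (2 * n), ε (2 * n + 1))`, `n ≥ 1`, are independent ... -/
  indep_noise :
    iIndepFun (fun (n : ℕ) (ω : Ω) => (ε (2 * (n + 1)) ω, ε (2 * (n + 1) + 1) ω)) μ
  /-- ... and identically distributed. -/
  ident_noise : ∀ n, 1 ≤ n →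
    IdentDistrib (fun ω => (ε (2 * n) ω, ε (2 * n + 1) ω)) (fun ω => (ε 2 ω, ε 3 ω)) μ μ
  /-- The two sequences of pairs are independent of each other. -/
  indep_coeff_noise :
    IndepFun (fun (ω : Ω) (n : ℕ) => (a (n + 1) ω, b (n + 1) ω))
      (fun (ω : Ω) (n : ℕ) => (ε (2 * (n + 1)) ω, ε (2 * (n + 1) + 1) ω)) μ
  /-- The recursion along the binary tree. -/
  even_child : ∀ n, 1 ≤ n → ∀ ω, X (2 * n) ω = a n ω * X n ω + ε (2 * n) ω
  odd_child : ∀ n, 1 ≤ n → ∀ ω, X (2 * n + 1) ω = b n ω * X n ω + ε (2 * n + 1) ω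

/-- The moment hypothesis (H.1): `E[a_n ^ 16] < 1` and `E[b_n ^ 16] < 1` for all `n ≥ 1`, and
the moments of order 16 of the noise are finite and bounded in `n`. -/
structure HypH1 {Ω : Type*} [MeasurableSpace Ω] (μ : Measure Ω)
    (a b ε : ℕ → Ω → ℝ) : Prop where
  coeff_a : ∀ n, 1 ≤ n →
    Integrable (fun ω => a n ω ^ 16) μ ∧ ∫ ω, a n ω ^ 16 ∂μ < 1
  coeff_b : ∀ n, 1 ≤ n →
    Integrable (fun ω => b n ω ^ 16) μ ∧ ∫ ω, b n ω ^ 16 ∂μ < 1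
  noise_even : ∃ M : ℝ, ∀ n, 1 ≤ n →
    Integrable (fun ω => ε (2 * n) ω ^ 16) μ ∧ ∫ ω, ε (2 * n) ω ^ 16 ∂μ ≤ M
  noise_odd : ∃ M : ℝ, ∀ n, 1 ≤ n →
    Integrable (fun ω => ε (2 * n + 1) ω ^ 16) μ ∧ ∫ ω, ε (2 * n + 1) ω ^ 16 ∂μ ≤ M

/-- The empirical moment of order `p` over all individuals up to generation `n`. -/
noncomputable def empiricalMoment {Ω : Type*} (X : ℕ → Ω → ℝ) (p n : ℕ) (ω : Ω) : ℝ :=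
  (1 / ((treeUpTo n).card : ℝ)) * ∑ k ∈ treeUpTo n, X k ω ^ p

/-! Let `G n` be the average of `X k ^ p` over generation `n`. Expanding both children of every `k`
by the binomial theorem and splitting each product of innovation powers into its mean and a centred
part writes `G (n + 1)` as `(A p + B p) / 2 * G n`, plus a combination of averages of lower powers,
plus averages of `X k ^ j` against centred innovations (`IsBifurcating.genAvg_pow_succ`). By
induction on `p` the lower averages converge. Since 16th moments of the coefficients below 1 force
`|A p| < 1` and `|B p| < 1`, the recursion is a perturbed contraction, with limit `limitMoment`.

The centred averages vanish almost surely. The innovation of an individual is independent of the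
past, so the summands are orthogonal; bounded 16th moments bound their second moments as long as the
powers are at most 8. The mean square over generation `n` is then `O(2 ^ (-n))`, which is summable
(`ae_tendsto_genAvg_of_orthogonal`).

Orthogonality is available for a deterministic ancestor, whereas `X 1` may depend on the
innovations. By linearity `X k = P k * X 1 + Y k`, where `Y` starts from 0 and `P` is the noise-free
process started from 1. For fixed `ω` the number `X 1 ω` factors out of the averages, and the
averages of `P k ^ j * Y k ^ i` with `j ≥ 1` vanish because the even moments of `P` decay
geometrically (`IsBifurcating.ae_tendsto_genAvg_mul_noiseless`). -/

/-! ### Averages over generations of the binary tree -/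

/-- A perturbed contraction converges as soon as its perturbation does. -/
lemma tendsto_of_affine_recursion {θ v₀ : ℝ} (hθ : |θ| < 1) {u v : ℕ → ℝ}
    (hu : ∀ n, u (n + 1) = θ * u n + v n) (hv : Tendsto v atTop (𝓝 v₀)) :
    Tendsto u atTop (𝓝 (v₀ / (1 - θ))) := by
  have hθ' : 1 - θ ≠ 0 := by have := (abs_lt.1 hθ).2; linarith
  have hpos : 0 < 1 - |θ| := by linarith
  rw [Metric.tendsto_atTop] at hv ⊢
  intro δ hδ
  -- With this threshold, `δ / 2` is the fixed point of `t ↦ |θ| * t + δ / 2 * (1 - |θ|)`, so the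
  -- bound `hbound` reproduces itself.
  obtain ⟨N, hN⟩ := hv (δ / 2 * (1 - |θ|)) (by positivity)
  set w : ℕ → ℝ := fun n => u n - v₀ / (1 - θ) with hw
  have hrec : ∀ n, w (n + 1) = θ * w n + (v n - v₀) := by
    intro n
    simp only [hw, hu]
    field_simp
    ring
  have hbound : ∀ k, |w (N + k)| ≤ |θ| ^ k * |w N| + δ / 2 := by
    intro k
    induction k with
    | zero => simp; positivity
    | succ k ih =>
      have h1 : |v (N + k) - v₀| ≤ δ / 2 * (1 - |θ|) := by
        have := (hN (N + k) (by omega)).le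
        rwa [Real.dist_eq] at this
      calc |w (N + (k + 1))| = |θ * w (N + k) + (v (N + k) - v₀)| := by
            rw [← add_assoc, hrec]
        _ ≤ |θ| * |w (N + k)| + |v (N + k) - v₀| := by
            rw [← abs_mul]; exact abs_add_le _ _
        _ ≤ |θ| * (|θ| ^ k * |w N| + δ / 2) + δ / 2 * (1 - |θ|) := by gcongr
        _ = |θ| ^ (k + 1) * |w N| + δ / 2 := by ring
  have hlim : Tendsto (fun k => |θ| ^ k * |w N|) atTop (𝓝 0) := by
    simpa using (tendsto_pow_atTop_nhds_zero_of_lt_one (abs_nonneg θ) hθ).mul_const |w N|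
  obtain ⟨M, hM⟩ := ((tendsto_order.1 hlim).2 (δ / 2) (by positivity)).exists_forall_of_atTop
  refine ⟨N + M, fun n hn => ?_⟩
  obtain ⟨k, rfl⟩ : ∃ k, n = N + k := ⟨n - N, by omega⟩
  rw [Real.dist_eq]
  have := hM k (by omega)
  have := hbound k
  simp only [hw] at *
  linarith

/-- The average of `f` over the `n`-th generation. -/
noncomputable def genAvg (f : ℕ → ℝ) (n : ℕ) : ℝ := (∑ k ∈ generation n, f k) / 2 ^ n

lemma one_le_of_mem_generation {n k : ℕ} (hk : k ∈ generation n) : 1 ≤ k := by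
  rw [generation, Finset.mem_Ico] at hk
  exact Nat.one_le_two_pow.trans hk.1

lemma generation_zero : generation 0 = {1} := rfl

lemma card_generation (n : ℕ) : (generation n).card = 2 ^ n := by
  rw [generation, Nat.card_Ico, pow_succ]; omega

lemma exists_parent_of_mem_generation_succ {n k : ℕ} (hk : k ∈ generation (n + 1)) :
    ∃ l ∈ generation n, k = 2 * l ∨ k = 2 * l + 1 := by
  simp only [generation, Finset.mem_Ico] at *
  refine ⟨k / 2, ?_, by omega⟩
  rw [pow_succ, pow_succ] at hk
  rw [pow_succ]
  omega

lemma sum_Ico_two_mul (f : ℕ → ℝ) {a b : ℕ} (hab : a ≤ b) :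
    ∑ k ∈ Finset.Ico (2 * a) (2 * b), f k =
      ∑ k ∈ Finset.Ico a b, (f (2 * k) + f (2 * k + 1)) := by
  induction b, hab using Nat.le_induction with
  | base => simp
  | succ b hab ih =>
    rw [Finset.sum_Ico_succ_top hab, ← ih, mul_add, mul_one,
      Finset.sum_Ico_succ_top (by omega : 2 * a ≤ 2 * b + 1),
      Finset.sum_Ico_succ_top (by omega : 2 * a ≤ 2 * b), add_assoc]

lemma genAvg_succ (f : ℕ → ℝ) (n : ℕ) :
    genAvg f (n + 1) = genAvg (fun k => f (2 * k) + f (2 * k + 1)) n / 2 := by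
  have h : ∑ k ∈ generation (n + 1), f k =
      ∑ k ∈ generation n, (f (2 * k) + f (2 * k + 1)) := by
    simp only [generation]
    rw [← sum_Ico_two_mul f (Nat.pow_le_pow_right (by norm_num) (Nat.le_succ n))]
    rw [← pow_succ', ← pow_succ']
  rw [genAvg, genAvg, h, pow_succ, div_div]

lemma genAvg_congr {f g : ℕ → ℝ} (h : ∀ k, 1 ≤ k → f k = g k) (n : ℕ) :
    genAvg f n = genAvg g n := by
  rw [genAvg, genAvg, Finset.sum_congr rfl fun k hk => h k (one_le_of_mem_generation hk)]

lemma genAvg_one (n : ℕ) : genAvg (fun _ => 1) n = 1 := by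
  simp [genAvg, card_generation]

lemma genAvg_add (f g : ℕ → ℝ) (n : ℕ) :
    genAvg (fun k => f k + g k) n = genAvg f n + genAvg g n := by
  simp only [genAvg, Finset.sum_add_distrib, add_div]

lemma genAvg_const_mul (c : ℝ) (f : ℕ → ℝ) (n : ℕ) :
    genAvg (fun k => c * f k) n = c * genAvg f n := by
  simp only [genAvg, ← Finset.mul_sum, mul_div_assoc]

lemma genAvg_finset_sum {ι : Type*} (s : Finset ι) (f : ι → ℕ → ℝ) (n : ℕ) :
    genAvg (fun k => ∑ i ∈ s, f i k) n = ∑ i ∈ s, genAvg (f i) n := by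
  simp only [genAvg, Finset.sum_comm (t := s), Finset.sum_div]

lemma treeUpTo_eq (n : ℕ) : treeUpTo n = Finset.Ico 1 (2 ^ (n + 1)) := by
  induction n with
  | zero => simp [treeUpTo, generation]
  | succ n ih =>
    rw [treeUpTo, Finset.range_add_one, Finset.biUnion_insert, ← treeUpTo, ih, generation,
      Finset.union_comm, Finset.Ico_union_Ico_eq_Ico Nat.one_le_two_pow
        (Nat.pow_le_pow_right (by norm_num) (Nat.le_succ _))]

/-- The normalised tree sum `u n` satisfies `u (n + 1) = u n / 2 + genAvg f (n + 1) / 2`, again a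
perturbed contraction. Dividing by `2 ^ (n + 1)` instead of `2 ^ (n + 1) - 1` does not change the
limit. -/
lemma tendsto_treeAvg {f : ℕ → ℝ} {L : ℝ} (h : Tendsto (genAvg f) atTop (𝓝 L)) :
    Tendsto (fun n => (1 / ((treeUpTo n).card : ℝ)) * ∑ k ∈ treeUpTo n, f k) atTop (𝓝 L) := by
  have h1 : Tendsto (fun n => (∑ k ∈ treeUpTo n, f k) / 2 ^ (n + 1)) atTop
      (𝓝 (L / 2 / (1 - 1 / 2))) := by
    refine tendsto_of_affine_recursion (by norm_num [abs_of_pos])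
      (v := fun n => genAvg f (n + 1) / 2) (fun n => ?_)
      ((h.comp (tendsto_add_atTop_nat 1)).div_const 2)
    have : ∑ k ∈ treeUpTo (n + 1), f k =
        ∑ k ∈ treeUpTo n, f k + ∑ k ∈ generation (n + 1), f k := by
      rw [treeUpTo_eq, treeUpTo_eq, generation, Finset.sum_Ico_consecutive _ Nat.one_le_two_pow
        (Nat.pow_le_pow_right (by norm_num) (Nat.le_succ _))]
    rw [this, genAvg]
    field_simp
    ring
  have h2 : Tendsto (fun n : ℕ => (1 - (1 / 2 : ℝ) ^ (n + 1))⁻¹) atTop (𝓝 1) := by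
    have := ((tendsto_pow_atTop_nhds_zero_of_lt_one (r := (1 / 2 : ℝ)) (by norm_num)
      (by norm_num)).comp (tendsto_add_atTop_nat 1)).const_sub 1
    simpa using this.inv₀ (by norm_num)
  have h3 := h2.mul h1
  have e : (1 : ℝ) * (L / 2 / (1 - 1 / 2)) = L := by ring
  rw [e] at h3
  refine h3.congr fun n => ?_
  have hc : ((treeUpTo n).card : ℝ) = 2 ^ (n + 1) - 1 := by
    rw [treeUpTo_eq, Nat.card_Ico, Nat.cast_sub Nat.one_le_two_pow]
    simp
  have h4 : (1 : ℝ) < 2 ^ (n + 1) := one_lt_pow₀ (by norm_num) (by omega)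
  have h5 : (2 : ℝ) ^ (n + 1) - 1 ≠ 0 := by linarith
  have h6 : 1 - (1 / 2 : ℝ) ^ (n + 1) = (2 ^ (n + 1) - 1) / 2 ^ (n + 1) := by
    rw [one_div, inv_pow]; field_simp
  rw [hc, h6]
  field_simp

/-! ### Almost sure convergence of generation averages to zero -/

section AlmostSure

variable {Ω : Type*} [MeasurableSpace Ω] {μ : Measure Ω}

/-- Nonnegative functions whose integrals decay geometrically tend to zero almost surely. -/
lemma ae_tendsto_zero_of_integral_le_geometric {W : ℕ → Ω → ℝ} {K r : ℝ}
    (hW : ∀ n, Integrable (W n) μ) (h0 : ∀ n ω, 0 ≤ W n ω) (hr0 : 0 ≤ r) (hr : r < 1)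
    (hK : ∀ n, ∫ ω, W n ω ∂μ ≤ K * r ^ n) :
    ∀ᵐ ω ∂μ, Tendsto (fun n => W n ω) atTop (𝓝 0) := by
  -- By Tonelli the series of the `W n` has finite integral, so it converges almost surely and its
  -- terms tend to zero.
  have hsum : ∫⁻ ω, ∑' n, ENNReal.ofReal (W n ω) ∂μ ≠ ⊤ := by
    rw [lintegral_tsum fun n => (hW n).aemeasurable.ennreal_ofReal]
    have hs : Summable fun n => ∫ ω, W n ω ∂μ :=
      Summable.of_nonneg_of_le (fun n => integral_nonneg (h0 n)) hK
        ((summable_geometric_of_lt_one hr0 hr).mul_left K)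
    have e : ∀ n, ∫⁻ ω, ENNReal.ofReal (W n ω) ∂μ = ENNReal.ofReal (∫ ω, W n ω ∂μ) := fun n =>
      (ofReal_integral_eq_lintegral_ofReal (hW n) (ae_of_all _ (h0 n))).symm
    simp only [e]
    rw [← ENNReal.ofReal_tsum_of_nonneg (fun n => integral_nonneg (h0 n)) hs]
    exact ENNReal.ofReal_ne_top
  have hm : AEMeasurable (fun ω => ∑' n, ENNReal.ofReal (W n ω)) μ :=
    AEMeasurable.tsum fun n => (hW n).aemeasurable.ennreal_ofReal
  filter_upwards [ae_lt_top' hm hsum] with ω hω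
  have h1 := ENNReal.tendsto_atTop_zero_of_tsum_ne_top hω.ne
  have h2 := (ENNReal.tendsto_toReal ENNReal.zero_ne_top).comp h1
  simpa [Function.comp_def, ENNReal.toReal_ofReal (h0 _ ω)] using h2

lemma ae_tendsto_genAvg_of_integral_abs_le {V : ℕ → Ω → ℝ} {K r : ℝ} (hr0 : 0 ≤ r) (hr : r < 1)
    (hV : ∀ k, 1 ≤ k → Integrable (V k) μ)
    (hK : ∀ n, ∀ k ∈ generation n, ∫ ω, |V k ω| ∂μ ≤ K * r ^ n) :
    ∀ᵐ ω ∂μ, Tendsto (genAvg fun k => V k ω) atTop (𝓝 0) := by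
  have hi : ∀ n, ∀ k ∈ generation n, Integrable (fun ω => |V k ω|) μ := fun n k hk =>
    (hV k (one_le_of_mem_generation hk)).abs
  have := ae_tendsto_zero_of_integral_le_geometric (μ := μ) (K := K) (r := r)
    (W := fun n ω => genAvg (fun k => |V k ω|) n)
    (fun n => (integrable_finsetSum _ (hi n)).div_const _)
    (fun n ω => by unfold genAvg; positivity) hr0 hr (fun n => by
      simp only [genAvg]
      rw [integral_div, integral_finsetSum _ (hi n), div_le_iff₀ (by positivity)]
      refine (Finset.sum_le_sum (hK n)).trans_eq ?_
      rw [Finset.sum_const, card_generation, nsmul_eq_mul]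
      push_cast
      ring)
  filter_upwards [this] with ω hω
  refine squeeze_zero_norm (fun n => ?_) hω
  rw [genAvg, genAvg, norm_div, Real.norm_eq_abs, Real.norm_eq_abs,
    abs_of_pos (by positivity : (0 : ℝ) < 2 ^ n)]
  gcongr
  exact Finset.abs_sum_le_sum_abs _ _

/-- Only the `2 ^ n` diagonal terms of the squared sum survive integration, so the squared average
has integral at most `K * 2 ^ n / 4 ^ n`. -/
lemma ae_tendsto_genAvg_of_orthogonal {V : ℕ → Ω → ℝ} {K : ℝ}
    (hV : ∀ k, 1 ≤ k → MemLp (V k) 2 μ)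
    (hK : ∀ k, 1 ≤ k → ∫ ω, V k ω ^ 2 ∂μ ≤ K)
    (horth : ∀ k l, 1 ≤ k → k < l → ∫ ω, V k ω * V l ω ∂μ = 0) :
    ∀ᵐ ω ∂μ, Tendsto (genAvg fun k => V k ω) atTop (𝓝 0) := by
  have hprod : ∀ n, ∀ k ∈ generation n, ∀ l ∈ generation n,
      Integrable (fun ω => V k ω * V l ω) μ := fun n k hk l hl =>
    (hV k (one_le_of_mem_generation hk)).integrable_mul (hV l (one_le_of_mem_generation hl))
  have hsq : ∀ n ω, genAvg (fun k => V k ω) n ^ 2 =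
      (∑ k ∈ generation n, ∑ l ∈ generation n, V k ω * V l ω) / 4 ^ n := by
    intro n ω
    rw [genAvg, div_pow, sq (∑ k ∈ generation n, V k ω), Finset.sum_mul_sum, ← pow_mul,
      mul_comm n 2, pow_mul]
    norm_num
  have := ae_tendsto_zero_of_integral_le_geometric (μ := μ) (K := K) (r := 1 / 2)
    (W := fun n ω => genAvg (fun k => V k ω) n ^ 2)
    (fun n => by
      simp only [hsq]
      exact (integrable_finsetSum _ fun k hk =>
        integrable_finsetSum _ fun l hl => hprod n k hk l hl).div_const _)
    (fun n ω => sq_nonneg _) (by norm_num) (by norm_num) (fun n => by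
      simp only [hsq]
      rw [integral_div, integral_finsetSum _ fun k hk =>
        integrable_finsetSum _ fun l hl => hprod n k hk l hl, div_le_iff₀ (by positivity)]
      have h1 : ∀ k ∈ generation n,
          ∫ ω, ∑ l ∈ generation n, V k ω * V l ω ∂μ ≤ K := by
        intro k hk
        rw [integral_finsetSum _ fun l hl => hprod n k hk l hl,
          Finset.sum_eq_single_of_mem k hk]
        · simpa only [sq] using hK k (one_le_of_mem_generation hk)
        · intro l hl hlk
          rcases lt_or_gt_of_ne hlk with h | h
          · simp_rw [mul_comm (V k _)]
            exact horth l k (one_le_of_mem_generation hl) h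
          · exact horth k l (one_le_of_mem_generation hk) h
      refine (Finset.sum_le_sum h1).trans_eq ?_
      rw [Finset.sum_const, card_generation, nsmul_eq_mul, mul_assoc, ← mul_pow]
      push_cast
      norm_num
      ring)
  filter_upwards [this] with ω hω
  have h2 := hω.sqrt
  simp only [Real.sqrt_sq_eq_abs, Real.sqrt_zero] at h2
  exact (tendsto_zero_iff_abs_tendsto_zero _).2 h2

end AlmostSure

/-! ### Moments up to order 16 -/

lemma abs_pow_le_one_add_pow_sixteen (x : ℝ) {i : ℕ} (hi : i ≤ 16) : |x ^ i| ≤ 1 + x ^ 16 := by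
  have h16 : x ^ 16 = |x| ^ 16 := (Even.pow_abs (by decide) x).symm
  rw [abs_pow, h16]
  rcases le_total |x| 1 with h | h
  · have := pow_le_one₀ (n := i) (abs_nonneg x) h
    have : 0 ≤ |x| ^ 16 := by positivity
    linarith
  · have := pow_le_pow_right₀ h hi
    linarith

/-- Bernoulli's inequality for the exponent `16 / i` at `|x| ^ i`. Equality at `|x| = 1` is what
turns a 16th moment below 1 into an `i`-th moment strictly below 1. -/
lemma abs_pow_le_affine_pow_sixteen (x : ℝ) {i : ℕ} (h1 : 1 ≤ i) (hi : i ≤ 16) :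
    |x ^ i| ≤ 1 + i / 16 * (x ^ 16 - 1) := by
  have h16 : x ^ 16 = |x| ^ 16 := (Even.pow_abs (by decide) x).symm
  rw [abs_pow, h16]
  set t := |x|
  have ht : 0 ≤ t := abs_nonneg x
  have hi0 : (0 : ℝ) < i := by exact_mod_cast h1
  have hi16 : (i : ℝ) ≤ 16 := by exact_mod_cast hi
  have hb := one_add_mul_self_le_rpow_one_add (s := t ^ i - 1) (p := 16 / i)
    (by have : 0 ≤ t ^ i := by positivity
        linarith) (by rw [le_div_iff₀ hi0]; linarith)
  have e : (1 + (t ^ i - 1)) ^ ((16 : ℝ) / i) = t ^ 16 := by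
    rw [add_sub_cancel, ← Real.rpow_natCast t i, ← Real.rpow_mul ht,
      mul_div_cancel₀ _ hi0.ne']
    exact_mod_cast Real.rpow_natCast t 16
  rw [e] at hb
  have : (i : ℝ) / 16 * (1 + 16 / i * (t ^ i - 1)) ≤ i / 16 * t ^ 16 := by gcongr
  have e2 : (i : ℝ) / 16 * (1 + 16 / i * (t ^ i - 1)) = i / 16 + (t ^ i - 1) := by
    field_simp
  linarith

/-- A splitting of the 16-th power of a sum that puts weight `l⁻¹ ^ 15` on the first summand. -/
lemma add_pow_sixteen_le {l : ℝ} (h0 : 0 < l) (h1 : l < 1) (x y : ℝ) :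
    (x + y) ^ 16 ≤ l⁻¹ ^ 15 * x ^ 16 + (1 - l)⁻¹ ^ 15 * y ^ 16 := by
  have h2 : 0 < 1 - l := by linarith
  -- Convexity at `x + y = l * (x / l) + (1 - l) * (y / (1 - l))`.
  have h := (Even.convexOn_pow (𝕜 := ℝ) (n := 16) (by decide)).2 (Set.mem_univ (l⁻¹ * x))
    (Set.mem_univ ((1 - l)⁻¹ * y)) h0.le h2.le (by ring)
  simp only [smul_eq_mul] at h
  rw [mul_inv_cancel_left₀ h0.ne', mul_inv_cancel_left₀ h2.ne'] at h
  refine h.trans_eq ?_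
  rw [mul_pow, mul_pow, pow_succ l⁻¹ 15, pow_succ (1 - l)⁻¹ 15]
  field_simp

/-! ### The past of an individual -/

/-- The sigma-algebra generated by the innovations of the individuals `1, …, l - 1`, where `m i`
is the one generated by the innovations of the individual `i + 1`. -/
@[reducible] def pastSigma {Ω : Type*} (m : ℕ → MeasurableSpace Ω) (l : ℕ) : MeasurableSpace Ω :=
  ⨆ i ∈ {i : ℕ | i + 1 < l}, m i

lemma le_pastSigma {Ω : Type*} {m : ℕ → MeasurableSpace Ω} {k l : ℕ} (hk : 1 ≤ k) (hkl : k < l) :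
    m (k - 1) ≤ pastSigma m l :=
  le_iSup₂ (f := fun i (_ : i ∈ {i : ℕ | i + 1 < l}) => m i) (k - 1)
    (by simp only [Set.mem_ofPred_eq]; omega)

lemma pastSigma_mono {Ω : Type*} {m : ℕ → MeasurableSpace Ω} {k l : ℕ} (hkl : k ≤ l) :
    pastSigma m k ≤ pastSigma m l :=
  biSup_mono fun i hi => by simp only [Set.mem_ofPred_eq] at *; omega

/-! ### Moment bounds, independence of the past, and a single branch -/

section Moments

variable {Ω : Type*} [mΩ : MeasurableSpace Ω] {μ : Measure Ω}

lemma integrable_pow_of_integrable_pow_sixteen [IsProbabilityMeasure μ] {f : Ω → ℝ} (hf : AEStronglyMeasurable f μ)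
    (h : Integrable (fun ω => f ω ^ 16) μ) {i : ℕ} (hi : i ≤ 16) :
    Integrable (fun ω => f ω ^ i) μ :=
  Integrable.mono' (g := fun ω => 1 + f ω ^ 16) ((integrable_const 1).add h) (hf.pow i)
    (ae_of_all _ fun ω => abs_pow_le_one_add_pow_sixteen (f ω) hi)

lemma abs_integral_pow_le [IsProbabilityMeasure μ] {f : Ω → ℝ} (h : Integrable (fun ω => f ω ^ 16) μ) {i : ℕ}
    (hi : i ≤ 16) : |∫ ω, f ω ^ i ∂μ| ≤ 1 + ∫ ω, f ω ^ 16 ∂μ := by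
  refine (norm_integral_le_of_norm_le (f := fun ω => f ω ^ i) (g := fun ω => 1 + f ω ^ 16)
    ((integrable_const 1).add h) (ae_of_all μ fun ω =>
    abs_pow_le_one_add_pow_sixteen (f ω) hi)).trans_eq ?_
  rw [integral_add (integrable_const _) h]
  simp

lemma abs_integral_pow_lt_one [IsProbabilityMeasure μ] {f : Ω → ℝ} (h : Integrable (fun ω => f ω ^ 16) μ)
    (hlt : ∫ ω, f ω ^ 16 ∂μ < 1) {i : ℕ} (h1 : 1 ≤ i) (hi : i ≤ 16) :
    |∫ ω, f ω ^ i ∂μ| < 1 := by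
  have hint : Integrable (fun ω => (i : ℝ) / 16 * (f ω ^ 16 - 1)) μ :=
    (h.sub (integrable_const 1)).const_mul _
  have hle := norm_integral_le_of_norm_le (f := fun ω => f ω ^ i) (g := fun ω => 1 + (i : ℝ) / 16 * (f ω ^ 16 - 1))
    ((integrable_const 1).add hint) (ae_of_all μ fun ω =>
    abs_pow_le_affine_pow_sixteen (f ω) h1 hi)
  rw [integral_add (integrable_const _) hint, integral_const_mul,
    integral_sub h (integrable_const _)] at hle
  simp only [integral_const, probReal_univ, smul_eq_mul, mul_one, Real.norm_eq_abs] at hle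
  have hi0 : (0 : ℝ) < i := by exact_mod_cast h1
  have : (i : ℝ) / 16 * (∫ ω, f ω ^ 16 ∂μ - 1) < 0 :=
    mul_neg_of_pos_of_neg (by positivity) (by linarith)
  linarith

lemma pastSigma_le {m : ℕ → MeasurableSpace Ω} (hm : ∀ i, m i ≤ mΩ) (l : ℕ) :
    pastSigma m l ≤ mΩ := iSup₂_le fun i _ => hm i

/-- The innovation of `l` has index `l - 1`, which fails `i + 1 < l`: past and innovation come from
disjoint blocks of an independent family. -/
lemma indep_pastSigma {m : ℕ → MeasurableSpace Ω} (hm : ∀ i, m i ≤ mΩ) (h : iIndep m μ) {l : ℕ}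
    (hl : 1 ≤ l) : Indep (pastSigma m l) (m (l - 1)) μ := by
  have := indep_iSup_of_disjoint hm h (S := {i : ℕ | i + 1 < l}) (T := {l - 1})
    (by simp only [Set.disjoint_singleton_right, Set.mem_ofPred_eq]; omega)
  simpa [pastSigma] using this

lemma integral_mul_of_indep {m₁ m₂ : MeasurableSpace Ω} (h : Indep m₁ m₂ μ) {U V : Ω → ℝ} (hU : Measurable[m₁] U) (hV : Measurable[m₂] V)
    (hUi : Integrable U μ) (hVi : Integrable V μ) :
    Integrable (fun ω => U ω * V ω) μ ∧
      ∫ ω, U ω * V ω ∂μ = (∫ ω, U ω ∂μ) * ∫ ω, V ω ∂μ := by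
  have hi : IndepFun U V μ := by
    rw [IndepFun_iff_Indep]
    exact indep_of_indep_of_le_left (indep_of_indep_of_le_right h hV.comap_le) hU.comap_le
  exact ⟨hi.integrable_mul hUi hVi,
    hi.integral_mul_eq_mul_integral hUi.aestronglyMeasurable hVi.aestronglyMeasurable⟩

/-- The random coefficients `α n` and noises `e n` of one of the two branches: they are measurable
with respect to the innovation of the individual `n`, independent of each other, have finite
moments `A i` and `C i` of order at most 16, and `A 16 < 1`. -/
structure IsBranch (μ : Measure Ω) (m : ℕ → MeasurableSpace Ω) (α e : ℕ → Ω → ℝ)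
    (A C : ℕ → ℝ) : Prop where
  measurable_coeff : ∀ n, 1 ≤ n → Measurable[m (n - 1)] (α n)
  measurable_noise : ∀ n, 1 ≤ n → Measurable[m (n - 1)] (e n)
  indep : ∀ n, 1 ≤ n → IndepFun (α n) (e n) μ
  integrable_coeff : ∀ n, 1 ≤ n → Integrable (fun ω => α n ω ^ 16) μ
  integrable_noise : ∀ n, 1 ≤ n → Integrable (fun ω => e n ω ^ 16) μ
  integral_coeff : ∀ n, 1 ≤ n → ∀ i, ∫ ω, α n ω ^ i ∂μ = A i
  integral_noise : ∀ n, 1 ≤ n → ∀ i, ∫ ω, e n ω ^ i ∂μ = C i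
  coeff_lt_one : A 16 < 1

namespace IsBranch

variable {m : ℕ → MeasurableSpace Ω} {α e : ℕ → Ω → ℝ} {A C : ℕ → ℝ}

lemma integrable_coeff_pow [IsProbabilityMeasure μ] (h : IsBranch μ m α e A C) (hm : ∀ i, m i ≤ mΩ) {n : ℕ} (hn : 1 ≤ n)
    {i : ℕ} (hi : i ≤ 16) : Integrable (fun ω => α n ω ^ i) μ :=
  integrable_pow_of_integrable_pow_sixteen
    ((h.measurable_coeff n hn).mono (hm _) le_rfl).aestronglyMeasurable (h.integrable_coeff n hn) hi

lemma integrable_noise_pow [IsProbabilityMeasure μ] (h : IsBranch μ m α e A C) (hm : ∀ i, m i ≤ mΩ) {n : ℕ} (hn : 1 ≤ n)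
    {i : ℕ} (hi : i ≤ 16) : Integrable (fun ω => e n ω ^ i) μ :=
  integrable_pow_of_integrable_pow_sixteen
    ((h.measurable_noise n hn).mono (hm _) le_rfl).aestronglyMeasurable (h.integrable_noise n hn) hi

lemma abs_coeff_moment_lt_one [IsProbabilityMeasure μ] (h : IsBranch μ m α e A C) {i : ℕ} (h1 : 1 ≤ i) (hi : i ≤ 16) :
    |A i| < 1 := by
  rw [← h.integral_coeff 1 le_rfl i]
  exact abs_integral_pow_lt_one (h.integrable_coeff 1 le_rfl)
    (by rw [h.integral_coeff 1 le_rfl]; exact h.coeff_lt_one) h1 hi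

lemma coeff_moment_nonneg (h : IsBranch μ m α e A C) {i : ℕ} (hi : Even i) : 0 ≤ A i := by
  rw [← h.integral_coeff 1 le_rfl i]
  exact integral_nonneg fun ω => hi.pow_nonneg _

lemma coeff_moment_zero [IsProbabilityMeasure μ] (h : IsBranch μ m α e A C) : A 0 = 1 := by
  rw [← h.integral_coeff 1 le_rfl 0]; simp

lemma noise_moment_zero [IsProbabilityMeasure μ] (h : IsBranch μ m α e A C) : C 0 = 1 := by
  rw [← h.integral_noise 1 le_rfl 0]; simp

lemma integrable_mul_pow [IsProbabilityMeasure μ] (h : IsBranch μ m α e A C) (hm : ∀ i, m i ≤ mΩ) {n : ℕ} (hn : 1 ≤ n)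
    {i j : ℕ} (hi : i ≤ 16) (hj : j ≤ 16) :
    Integrable (fun ω => α n ω ^ i * e n ω ^ j) μ :=
  ((h.indep n hn).comp (measurable_id.pow_const i) (measurable_id.pow_const j)).integrable_mul
    (h.integrable_coeff_pow hm hn hi) (h.integrable_noise_pow hm hn hj)

lemma integral_mul_pow [IsProbabilityMeasure μ] (h : IsBranch μ m α e A C) (hm : ∀ i, m i ≤ mΩ) {n : ℕ} (hn : 1 ≤ n)
    {i j : ℕ} (hi : i ≤ 16) (hj : j ≤ 16) :
    ∫ ω, α n ω ^ i * e n ω ^ j ∂μ = A i * C j := by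
  rw [← h.integral_coeff n hn i, ← h.integral_noise n hn j]
  exact ((h.indep n hn).comp (measurable_id.pow_const i)
    (measurable_id.pow_const j)).integral_mul_eq_mul_integral
    (h.integrable_coeff_pow hm hn hi).aestronglyMeasurable
    (h.integrable_noise_pow hm hn hj).aestronglyMeasurable

/-- The noise-free branch. -/
lemma zero_noise [IsProbabilityMeasure μ] (h : IsBranch μ m α e A C) :
    IsBranch μ m α (fun _ _ => 0) A (fun i => 0 ^ i) where
  measurable_coeff := h.measurable_coeff
  measurable_noise _ _ := measurable_const
  indep n _ := (indepFun_const_right _ 0)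
  integrable_coeff := h.integrable_coeff
  integrable_noise _ _ := by simp
  integral_coeff := h.integral_coeff
  integral_noise _ _ i := by simp
  coeff_lt_one := h.coeff_lt_one

/-- One step along a branch contracts 16-th moments up to an additive constant. -/
lemma exists_moment_contraction [IsProbabilityMeasure μ] (h : IsBranch μ m α e A C) (hm : ∀ i, m i ≤ mΩ)
    (hind : iIndep m μ) :
    ∃ ρ κ : ℝ, 0 ≤ ρ ∧ ρ < 1 ∧ 0 ≤ κ ∧ ∀ n, 1 ≤ n → ∀ U : Ω → ℝ, Measurable[pastSigma m n] U →
      Integrable (fun ω => U ω ^ 16) μ →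
        Integrable (fun ω => (α n ω * U ω + e n ω) ^ 16) μ ∧
          ∫ ω, (α n ω * U ω + e n ω) ^ 16 ∂μ ≤ ρ * ∫ ω, U ω ^ 16 ∂μ + κ := by
  have hA0 : 0 ≤ A 16 := h.coeff_moment_nonneg (by decide)
  have hA1 := h.coeff_lt_one
  -- By Bernoulli, `l ^ 15 ≥ 1 - 15 / 16 * (1 - A 16) > A 16`, so the splitting weight `l⁻¹ ^ 15`
  -- keeps the factor `l⁻¹ ^ 15 * A 16` below 1.
  set l : ℝ := 1 + -((1 - A 16) / 16) with hl
  have hl0 : 0 < l := by rw [hl]; linarith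
  have hl1 : l < 1 := by rw [hl]; linarith
  have hl2 : A 16 < l ^ 15 := by
    have := one_add_mul_le_pow (a := -((1 - A 16) / 16)) (by linarith) 15
    rw [← hl] at this
    push_cast at this
    linarith
  have hC0 : 0 ≤ C 16 := by
    rw [← h.integral_noise 1 le_rfl 16]
    exact integral_nonneg fun ω => Even.pow_nonneg (by decide) _
  have hl3 : 0 < 1 - l := by linarith
  refine ⟨l⁻¹ ^ 15 * A 16, (1 - l)⁻¹ ^ 15 * C 16, by positivity, ?_, by positivity,
    fun n hn U hU hUi => ?_⟩
  · rw [inv_pow, inv_mul_lt_iff₀ (by positivity)]; linarith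
  obtain ⟨hi, he⟩ := integral_mul_of_indep (indep_pastSigma hm hind hn) (hU.pow_const 16) ((h.measurable_coeff n hn).pow_const 16)
    hUi (h.integrable_coeff n hn)
  have hdom : Integrable (fun ω => l⁻¹ ^ 15 * (U ω ^ 16 * α n ω ^ 16) +
      (1 - l)⁻¹ ^ 15 * e n ω ^ 16) μ :=
    (hi.const_mul _).add ((h.integrable_noise n hn).const_mul _)
  have hle : ∀ ω, (α n ω * U ω + e n ω) ^ 16 ≤
      l⁻¹ ^ 15 * (U ω ^ 16 * α n ω ^ 16) + (1 - l)⁻¹ ^ 15 * e n ω ^ 16 := by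
    intro ω
    rw [mul_comm (U ω ^ 16), ← mul_pow]
    exact add_pow_sixteen_le hl0 hl1 _ _
  have hmeas : Measurable (fun ω => (α n ω * U ω + e n ω) ^ 16) :=
    ((((h.measurable_coeff n hn).mono (hm _) le_rfl).mul
      (hU.mono (pastSigma_le hm n) le_rfl)).add
      ((h.measurable_noise n hn).mono (hm _) le_rfl)).pow_const 16
  have hint : Integrable (fun ω => (α n ω * U ω + e n ω) ^ 16) μ :=
    hdom.mono' hmeas.aestronglyMeasurable (ae_of_all _ fun ω => by
      rw [Real.norm_of_nonneg (Even.pow_nonneg (by decide) _)]; exact hle ω)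
  refine ⟨hint, (integral_mono hint hdom hle).trans_eq ?_⟩
  rw [integral_add (hi.const_mul _) ((h.integrable_noise n hn).const_mul _), integral_const_mul,
    integral_const_mul, he, h.integral_coeff n hn, h.integral_noise n hn]
  ring

/-- The weak law behind the recursion: averages of `Y ^ j` against centred innovations vanish. -/
lemma ae_tendsto_genAvg_centred [IsProbabilityMeasure μ] (h : IsBranch μ m α e A C) (hm : ∀ i, m i ≤ mΩ)
    (hind : iIndep m μ) {Y : ℕ → Ω → ℝ} {T : ℝ}
    (hY : ∀ k, 1 ≤ k → Measurable[pastSigma m k] (Y k))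
    (hYi : ∀ k, 1 ≤ k → Integrable (fun ω => Y k ω ^ 16) μ)
    (hYT : ∀ k, 1 ≤ k → ∫ ω, Y k ω ^ 16 ∂μ ≤ T) {i j l : ℕ} (hi : i ≤ 8) (hj : j ≤ 8)
    (hl : l ≤ 8) :
    ∀ᵐ ω ∂μ, Tendsto (genAvg fun k => Y k ω ^ j * (α k ω ^ i * e k ω ^ l - A i * C l))
      atTop (𝓝 0) := by
  set ξ : ℕ → Ω → ℝ := fun k ω => α k ω ^ i * e k ω ^ l - A i * C l with hξ
  have hξm : ∀ k, 1 ≤ k → Measurable[m (k - 1)] (ξ k) := fun k hk =>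
    (((h.measurable_coeff k hk).pow_const i).mul
      ((h.measurable_noise k hk).pow_const l)).sub_const _
  have hξi : ∀ k, 1 ≤ k → Integrable (ξ k) μ := fun k hk =>
    (h.integrable_mul_pow hm hk (by omega) (by omega)).sub (integrable_const _)
  have hξ0 : ∀ k, 1 ≤ k → ∫ ω, ξ k ω ∂μ = 0 := fun k hk => by
    simp only [hξ]
    rw [integral_sub (h.integrable_mul_pow hm hk (by omega) (by omega)) (integrable_const _),
      h.integral_mul_pow hm hk (by omega) (by omega)]
    simp
  -- The cross term is written with `ξ` itself, so that it integrates to zero.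
  have hξsq : ∀ k ω, ξ k ω ^ 2 = α k ω ^ (2 * i) * e k ω ^ (2 * l) -
      2 * (A i * C l) * ξ k ω - (A i * C l) ^ 2 := fun k ω => by
    simp only [hξ]; ring
  have hξ2i : ∀ k, 1 ≤ k → Integrable (fun ω => ξ k ω ^ 2) μ := fun k hk => by
    simp only [hξsq]
    exact ((h.integrable_mul_pow hm hk (by omega) (by omega)).sub
      ((hξi k hk).const_mul _)).sub (integrable_const _)
  have hξ2 : ∀ k, 1 ≤ k → ∫ ω, ξ k ω ^ 2 ∂μ ≤ A (2 * i) * C (2 * l) := fun k hk => by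
    simp only [hξsq]
    have h1 : Integrable (fun ω => α k ω ^ (2 * i) * e k ω ^ (2 * l) -
        2 * (A i * C l) * ξ k ω) μ :=
      (h.integrable_mul_pow hm hk (by omega) (by omega)).sub ((hξi k hk).const_mul _)
    rw [integral_sub h1 (integrable_const _),
      integral_sub (h.integrable_mul_pow hm hk (by omega) (by omega)) ((hξi k hk).const_mul _),
      integral_const_mul, hξ0 k hk, h.integral_mul_pow hm hk (by omega) (by omega)]
    simp only [integral_const, probReal_univ, smul_eq_mul]
    nlinarith [sq_nonneg (A i * C l)]
  have hYm : ∀ k, 1 ≤ k → Measurable (Y k) := fun k hk =>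
    (hY k hk).mono (pastSigma_le hm k) le_rfl
  have hξm' : ∀ k, 1 ≤ k → Measurable (ξ k) := fun k hk => (hξm k hk).mono (hm _) le_rfl
  have hYp : ∀ k, 1 ≤ k → ∀ q ≤ 16, Integrable (fun ω => Y k ω ^ q) μ := fun k hk q hq =>
    integrable_pow_of_integrable_pow_sixteen (hYm k hk).aestronglyMeasurable (hYi k hk) hq
  -- The past factor and the innovation factor separate. The exponent `j * 2` is at most 16, hence
  -- the restriction to powers up to 8.
  have key : ∀ k, 1 ≤ k → Integrable (fun ω => Y k ω ^ (j * 2) * ξ k ω ^ 2) μ ∧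
      ∫ ω, Y k ω ^ (j * 2) * ξ k ω ^ 2 ∂μ =
        (∫ ω, Y k ω ^ (j * 2) ∂μ) * ∫ ω, ξ k ω ^ 2 ∂μ := fun k hk =>
    integral_mul_of_indep (indep_pastSigma hm hind hk)
      ((hY k hk).pow_const _) ((hξm k hk).pow_const _) (hYp k hk _ (by omega)) (hξ2i k hk)
  have hV2 : ∀ k, 1 ≤ k → MemLp (fun ω => Y k ω ^ j * ξ k ω) 2 μ := fun k hk => by
    have hmk : Measurable fun ω => Y k ω ^ j * ξ k ω := ((hYm k hk).pow_const j).mul (hξm' k hk)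
    rw [memLp_two_iff_integrable_sq hmk.aestronglyMeasurable]
    simpa only [mul_pow, ← pow_mul] using (key k hk).1
  refine ae_tendsto_genAvg_of_orthogonal (K := (1 + T) * (A (2 * i) * C (2 * l))) hV2
    (fun k hk => ?_) fun k n hk hkn => ?_
  · simp only [mul_pow, ← pow_mul]
    rw [(key k hk).2]
    have h1 := (le_abs_self _).trans (abs_integral_pow_le (hYi k hk) (i := j * 2) (by omega))
    have h2 := hYT k hk
    have h3 : 0 ≤ ∫ ω, Y k ω ^ (j * 2) ∂μ := integral_nonneg fun ω =>
      Even.pow_nonneg (by simp) _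
    exact mul_le_mul (by linarith) (hξ2 k hk) (integral_nonneg fun ω => sq_nonneg _)
      (by linarith)
  · have hn : 1 ≤ n := by omega
    have hYn : MemLp (fun ω => Y n ω ^ j) 2 μ := by
      rw [memLp_two_iff_integrable_sq ((hYm n hn).pow_const j).aestronglyMeasurable]
      simpa only [← pow_mul] using hYp n hn _ (by omega)
    -- For `k < n` everything except `ξ n` belongs to the past of `n`, and `ξ n` is centred.
    have := (integral_mul_of_indep (indep_pastSigma hm hind hn)
      (U := fun ω => Y k ω ^ j * ξ k ω * Y n ω ^ j) (V := ξ n)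
      (((((hY k hk).mono (pastSigma_mono hkn.le) le_rfl).pow_const j).mul
        ((hξm k hk).mono (le_pastSigma hk hkn) le_rfl)).mul ((hY n hn).pow_const j))
      (hξm n hn) ((hV2 k hk).integrable_mul hYn) (hξi n hn)).2
    rw [hξ0 n hn, mul_zero] at this
    rw [← this]
    congr 1
    ext ω
    ring

end IsBranch

end Moments

/-! ### Bifurcating processes with a deterministic ancestor -/

/-- `Y` starts from the constant `x` and follows the bifurcating recursion with coefficients
`α n`, `β n` and noises `e n`, `f n`. -/
structure IsBifurcating {Ω : Type*} (x : ℝ) (α e β f Y : ℕ → Ω → ℝ) : Prop where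
  root : ∀ ω, Y 1 ω = x
  even_child : ∀ n, 1 ≤ n → ∀ ω, Y (2 * n) ω = α n ω * Y n ω + e n ω
  odd_child : ∀ n, 1 ≤ n → ∀ ω, Y (2 * n + 1) ω = β n ω * Y n ω + f n ω

/-- The bifurcating process started from `x`. -/
noncomputable def bifProcess {Ω : Type*} (x : ℝ) (α e β f : ℕ → Ω → ℝ) : ℕ → Ω → ℝ
  -- A filler value: parents have index at least 1, so the recursion never reaches it.
  | 0 => fun _ => 0
  | 1 => fun _ => x
  -- The individual `n + 2` has the parity of `n` and the parent `n / 2 + 1`.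
  | n + 2 => fun ω =>
    if Even n then α (n / 2 + 1) ω * bifProcess x α e β f (n / 2 + 1) ω + e (n / 2 + 1) ω
    else β (n / 2 + 1) ω * bifProcess x α e β f (n / 2 + 1) ω + f (n / 2 + 1) ω
  termination_by n => n
  decreasing_by all_goals omega

lemma isBifurcating_bifProcess {Ω : Type*} (x : ℝ) (α e β f : ℕ → Ω → ℝ) :
    IsBifurcating x α e β f (bifProcess x α e β f) where
  root ω := by rw [bifProcess]
  even_child n hn ω := by
    obtain ⟨k, rfl⟩ := Nat.exists_eq_add_of_le' hn
    rw [show 2 * (k + 1) = 2 * k + 2 by ring, bifProcess]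
    simp
  odd_child n hn ω := by
    obtain ⟨k, rfl⟩ := Nat.exists_eq_add_of_le' hn
    rw [show 2 * (k + 1) + 1 = (2 * k + 1) + 2 by ring, bifProcess,
      show (2 * k + 1) / 2 = k by omega]
    simp

lemma binary_tree_induction {P : ℕ → Prop} (h1 : P 1) (he : ∀ n, 1 ≤ n → P n → P (2 * n))
    (ho : ∀ n, 1 ≤ n → P n → P (2 * n + 1)) : ∀ n, 1 ≤ n → P n := by
  intro n
  induction n using Nat.strong_induction_on with
  | _ n ih =>
    intro hn
    rcases Nat.even_or_odd' n with ⟨k, rfl | rfl⟩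
    · exact he k (by omega) (ih k (by omega) (by omega))
    · rcases Nat.eq_zero_or_pos k with rfl | hk
      · simpa using h1
      · exact ho k hk (ih k (by omega) hk)

namespace IsBifurcating

variable {Ω : Type*} [mΩ : MeasurableSpace Ω] {μ : Measure Ω} {m : ℕ → MeasurableSpace Ω}
  {α e β f Y : ℕ → Ω → ℝ} {A B C D : ℕ → ℝ} {x : ℝ}

/-- The root is constant and every child has a larger index than its parent, so `Y k` involves only
innovations of individuals before `k`. -/
lemma measurable_pastSigma (hY : IsBifurcating x α e β f Y) (h : IsBranch μ m α e A C)
    (h' : IsBranch μ m β f B D) : ∀ k, 1 ≤ k → Measurable[pastSigma m k] (Y k) := by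
  refine binary_tree_induction ?_ (fun n hn ih => ?_) fun n hn ih => ?_
  · rw [show Y 1 = fun _ => x from funext hY.root]
    exact measurable_const
  · rw [show Y (2 * n) = fun ω => α n ω * Y n ω + e n ω from funext (hY.even_child n hn)]
    exact (((h.measurable_coeff n hn).mono (le_pastSigma hn (by omega)) le_rfl).mul
      (ih.mono (pastSigma_mono (by omega)) le_rfl)).add
      ((h.measurable_noise n hn).mono (le_pastSigma hn (by omega)) le_rfl)
  · rw [show Y (2 * n + 1) = fun ω => β n ω * Y n ω + f n ω from funext (hY.odd_child n hn)]
    exact (((h'.measurable_coeff n hn).mono (le_pastSigma hn (by omega)) le_rfl).mul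
      (ih.mono (pastSigma_mono (by omega)) le_rfl)).add
      ((h'.measurable_noise n hn).mono (le_pastSigma hn (by omega)) le_rfl)

lemma exists_moment_bound [IsProbabilityMeasure μ] (hY : IsBifurcating x α e β f Y)
    (h : IsBranch μ m α e A C) (h' : IsBranch μ m β f B D) (hm : ∀ i, m i ≤ mΩ)
    (hind : iIndep m μ) :
    ∃ T : ℝ, ∀ k, 1 ≤ k → Integrable (fun ω => Y k ω ^ 16) μ ∧ ∫ ω, Y k ω ^ 16 ∂μ ≤ T := by
  obtain ⟨ρ, κ, hρ0, hρ1, hκ, hs⟩ := h.exists_moment_contraction hm hind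
  obtain ⟨ρ', κ', hρ0', hρ1', hκ', hs'⟩ := h'.exists_moment_contraction hm hind
  have hYm := hY.measurable_pastSigma h h'
  -- `T` dominates the root and the fixed points of both maps `t ↦ ρ * t + κ` and `t ↦ ρ' * t + κ'`,
  -- hence is stable under both.
  set T : ℝ := x ^ 16 + κ / (1 - ρ) + κ' / (1 - ρ') with hT
  have hx : 0 ≤ x ^ 16 := Even.pow_nonneg (by decide) x
  have h1 : 0 < 1 - ρ := by linarith
  have h1' : 0 < 1 - ρ' := by linarith
  have h2 : 0 ≤ κ / (1 - ρ) := by positivity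
  have h2' : 0 ≤ κ' / (1 - ρ') := by positivity
  have step : ρ * T + κ ≤ T := by
    have : (1 - ρ) * (κ / (1 - ρ)) = κ := by field_simp
    have : 0 ≤ (1 - ρ) * (x ^ 16 + κ' / (1 - ρ')) := by positivity
    rw [hT]; linarith
  have step' : ρ' * T + κ' ≤ T := by
    have : (1 - ρ') * (κ' / (1 - ρ')) = κ' := by field_simp
    have : 0 ≤ (1 - ρ') * (x ^ 16 + κ / (1 - ρ)) := by positivity
    rw [hT]; linarith
  refine ⟨T, binary_tree_induction ?_ (fun n hn ih => ?_) fun n hn ih => ?_⟩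
  · simp only [hY.root]
    refine ⟨integrable_const _, ?_⟩
    simp only [integral_const, probReal_univ, smul_eq_mul, one_mul]
    rw [hT]; linarith
  · simp only [hY.even_child n hn]
    obtain ⟨h3, h4⟩ := hs n hn (Y n) (hYm n hn) ih.1
    exact ⟨h3, h4.trans (by nlinarith [mul_le_mul_of_nonneg_left ih.2 hρ0])⟩
  · simp only [hY.odd_child n hn]
    obtain ⟨h3, h4⟩ := hs' n hn (Y n) (hYm n hn) ih.1
    exact ⟨h3, h4.trans (by nlinarith [mul_le_mul_of_nonneg_left ih.2 hρ0'])⟩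

/-- Without noise, even moments decay geometrically along the generations. -/
lemma integral_pow_le_of_noiseless [IsProbabilityMeasure μ] {P : ℕ → Ω → ℝ}
    (hP : IsBifurcating 1 α (fun _ _ => 0) β (fun _ _ => 0) P)
    (h : IsBranch μ m α e A C) (h' : IsBranch μ m β f B D) (hm : ∀ i, m i ≤ mΩ)
    (hind : iIndep m μ) {q : ℕ} (hq : Even q) (hq16 : q ≤ 16) {R : ℝ}
    (hA : A q ≤ R) (hB : B q ≤ R) :
    ∀ n, ∀ k ∈ generation n, ∫ ω, P k ω ^ q ∂μ ≤ R ^ n := by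
  obtain ⟨T, hT⟩ := hP.exists_moment_bound h.zero_noise h'.zero_noise hm hind
  have hPm := hP.measurable_pastSigma h.zero_noise h'.zero_noise
  have hR : 0 ≤ R := (h.coeff_moment_nonneg hq).trans hA
  have hPq : ∀ k, 1 ≤ k → Integrable (fun ω => P k ω ^ q) μ := fun k hk =>
    integrable_pow_of_integrable_pow_sixteen
      ((hPm k hk).mono (pastSigma_le hm k) le_rfl).aestronglyMeasurable (hT k hk).1 hq16
  -- Shared by both branches: the coefficient is independent of `P l`, so one step multiplies the
  -- `q`-th moment by at most `R`.
  have hstep : ∀ {γ g : ℕ → Ω → ℝ} {E F : ℕ → ℝ}, IsBranch μ m γ g E F → E q ≤ R →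
      ∀ l, 1 ≤ l → ∀ n, ∫ ω, P l ω ^ q ∂μ ≤ R ^ n →
        ∫ ω, (γ l ω * P l ω + 0) ^ q ∂μ ≤ R ^ (n + 1) := by
    intro γ g E F hγ hE l hl n hn
    simp only [add_zero, mul_pow, mul_comm (γ l _ ^ q)]
    rw [(integral_mul_of_indep (indep_pastSigma hm hind hl) ((hPm l hl).pow_const q)
      ((hγ.measurable_coeff l hl).pow_const q) (hPq l hl)
      (hγ.integrable_coeff_pow hm hl hq16)).2, hγ.integral_coeff l hl, pow_succ]
    exact mul_le_mul hn hE (hγ.coeff_moment_nonneg hq) (by positivity)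
  intro n
  induction n with
  | zero =>
    intro k hk
    rw [generation_zero, Finset.mem_singleton] at hk
    simp [hk, hP.root]
  | succ n ih =>
    intro k hk
    obtain ⟨l, hl, rfl | rfl⟩ := exists_parent_of_mem_generation_succ hk
    · have hl1 := one_le_of_mem_generation hl
      simp only [hP.even_child l hl1]
      exact hstep h hA l hl1 n (ih l hl)
    · have hl1 := one_le_of_mem_generation hl
      simp only [hP.odd_child l hl1]
      exact hstep h' hB l hl1 n (ih l hl)

/-- The influence of the ancestor vanishes in the limit. -/
lemma ae_tendsto_genAvg_mul_noiseless [IsProbabilityMeasure μ] {P : ℕ → Ω → ℝ}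
    (hY : IsBifurcating x α e β f Y)
    (hP : IsBifurcating 1 α (fun _ _ => 0) β (fun _ _ => 0) P)
    (h : IsBranch μ m α e A C) (h' : IsBranch μ m β f B D) (hm : ∀ i, m i ≤ mΩ)
    (hind : iIndep m μ) {i j : ℕ} (hi : i ≤ 8) (hj0 : 1 ≤ j) (hj : j ≤ 8) :
    ∀ᵐ ω ∂μ, Tendsto (genAvg fun k => P k ω ^ j * Y k ω ^ i) atTop (𝓝 0) := by
  obtain ⟨T, hT⟩ := hY.exists_moment_bound h h' hm hind
  obtain ⟨S, hS⟩ := hP.exists_moment_bound h.zero_noise h'.zero_noise hm hind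
  have hYm : ∀ k, 1 ≤ k → Measurable (Y k) := fun k hk =>
    (hY.measurable_pastSigma h h' k hk).mono (pastSigma_le hm k) le_rfl
  have hPm : ∀ k, 1 ≤ k → Measurable (P k) := fun k hk =>
    (hP.measurable_pastSigma h.zero_noise h'.zero_noise k hk).mono (pastSigma_le hm k) le_rfl
  have hYi : ∀ k, 1 ≤ k → Integrable (fun ω => Y k ω ^ (i * 2)) μ := fun k hk =>
    integrable_pow_of_integrable_pow_sixteen (hYm k hk).aestronglyMeasurable (hT k hk).1 (by omega)
  have hPi : ∀ k, 1 ≤ k → Integrable (fun ω => P k ω ^ (j * 2)) μ := fun k hk =>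
    integrable_pow_of_integrable_pow_sixteen (hPm k hk).aestronglyMeasurable (hS k hk).1 (by omega)
  have heven : Even (j * 2) := even_two.mul_left j
  set M := max (A (j * 2)) (B (j * 2)) with hM
  have hM0 : 0 ≤ M := (h.coeff_moment_nonneg heven).trans (le_max_left _ _)
  have hM1 : M < 1 := max_lt (abs_lt.1 (h.abs_coeff_moment_lt_one (by omega) (by omega))).2
    (abs_lt.1 (h'.abs_coeff_moment_lt_one (by omega) (by omega))).2
  -- This `r` is positive, below 1, and satisfies `M ≤ r ^ 2`; thus the moment of `P k` of order `j
  -- * 2` is at most `r ^ (2 * n)` on generation `n`.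
  set r := (1 + M) / 2 with hr
  have hr0 : 0 < r := by rw [hr]; linarith
  have hr1 : r < 1 := by rw [hr]; linarith
  have hMr : M ≤ r ^ 2 := by rw [hr]; nlinarith [sq_nonneg (1 - M)]
  have hdec := hP.integral_pow_le_of_noiseless h h' hm hind heven (by omega)
    ((le_max_left _ _).trans hMr) ((le_max_right _ _).trans hMr)
  refine ae_tendsto_genAvg_of_integral_abs_le (K := (2 + T) / 2) hr0.le hr1
    (fun k hk => ?_) fun n k hk => ?_
  · have h1 : MemLp (fun ω => P k ω ^ j) 2 μ := by
      rw [memLp_two_iff_integrable_sq ((hPm k hk).pow_const j).aestronglyMeasurable]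
      simpa only [← pow_mul] using hPi k hk
    have h2 : MemLp (fun ω => Y k ω ^ i) 2 μ := by
      rw [memLp_two_iff_integrable_sq ((hYm k hk).pow_const i).aestronglyMeasurable]
      simpa only [← pow_mul] using hYi k hk
    exact h1.integrable_mul h2
  · have hk1 := one_le_of_mem_generation hk
    have hrn : 0 < r ^ n := by positivity
    -- Young's inequality, weighted by `r ^ n` so that both terms have integral of order `r ^ n`.
    have hle : ∀ ω, ‖|P k ω ^ j * Y k ω ^ i|‖ ≤
        (r ^ n)⁻¹ / 2 * P k ω ^ (j * 2) + r ^ n / 2 * Y k ω ^ (i * 2) := by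
      intro ω
      rw [Real.norm_eq_abs, abs_abs, abs_mul, pow_mul, pow_mul, ← sq_abs (P k ω ^ j),
        ← sq_abs (Y k ω ^ i)]
      set u := |P k ω ^ j|
      set v := |Y k ω ^ i|
      have : (r ^ n)⁻¹ / 2 * u ^ 2 + r ^ n / 2 * v ^ 2 - u * v =
          (r ^ n)⁻¹ / 2 * (u - r ^ n * v) ^ 2 := by
        field_simp; ring
      have : 0 ≤ (r ^ n)⁻¹ / 2 * (u - r ^ n * v) ^ 2 := by positivity
      linarith
    have h1 := norm_integral_le_of_norm_le
      (g := fun ω => (r ^ n)⁻¹ / 2 * P k ω ^ (j * 2) + r ^ n / 2 * Y k ω ^ (i * 2))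
      (((hPi k hk1).const_mul _).add ((hYi k hk1).const_mul _)) (ae_of_all μ hle)
    rw [integral_add ((hPi k hk1).const_mul _) ((hYi k hk1).const_mul _), integral_const_mul,
      integral_const_mul] at h1
    have h2 := (le_abs_self _).trans (abs_integral_pow_le (hT k hk1).1 (i := i * 2) (by omega))
    have h3 : ∫ ω, Y k ω ^ (i * 2) ∂μ ≤ 1 + T := by linarith [(hT k hk1).2]
    calc ∫ ω, |P k ω ^ j * Y k ω ^ i| ∂μ ≤ ‖∫ ω, |P k ω ^ j * Y k ω ^ i| ∂μ‖ := le_abs_self _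
      _ ≤ _ := h1
      _ ≤ (r ^ n)⁻¹ / 2 * (r ^ 2) ^ n + r ^ n / 2 * (1 + T) := by
        gcongr
        exact hdec n k hk
      _ = (2 + T) / 2 * r ^ n := by
        rw [← pow_mul, mul_comm 2 n, pow_mul]
        field_simp
        ring

end IsBifurcating

/-! ### The limits of the empirical moments -/

/-- The limiting empirical moments, as a function of the moments of coefficients and noises. -/
noncomputable def limitMoment (A B C D : ℕ → ℝ) : ℕ → ℝ
  -- The limit of the averages of zeroth powers; it lets the term `j = 0` of the binomial expansion
  -- be treated like the others.
  | 0 => 1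
  | p + 1 => 2 / (2 - (A (p + 1) + B (p + 1))) *
      (∑ k ∈ (Finset.Icc 1 p).attach, (1 / 2 : ℝ) * ((p + 1).choose k.1 : ℝ) *
          (A k.1 * C (p + 1 - k.1) + B k.1 * D (p + 1 - k.1)) * limitMoment A B C D k.1 +
        (C (p + 1) + D (p + 1)) / 2)
  termination_by p => p
  decreasing_by
    have := Finset.mem_Icc.1 k.2
    omega

lemma limitMoment_eq (A B C D : ℕ → ℝ) {p : ℕ} (hp : 1 ≤ p) :
    limitMoment A B C D p = 2 / (2 - (A p + B p)) *
      (∑ k ∈ Finset.Icc 1 (p - 1), (1 / 2 : ℝ) * (p.choose k : ℝ) *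
          (A k * C (p - k) + B k * D (p - k)) * limitMoment A B C D k + (C p + D p) / 2) := by
  obtain ⟨p, rfl⟩ := Nat.exists_eq_add_of_le' hp
  rw [limitMoment, Nat.add_sub_cancel, Finset.sum_attach (Finset.Icc 1 p) (fun k =>
    (1 / 2 : ℝ) * ((p + 1).choose k : ℝ) *
      (A k * C (p + 1 - k) + B k * D (p + 1 - k)) * limitMoment A B C D k)]

lemma limitMoment_congr {A B C D A' B' C' D' : ℕ → ℝ} {p : ℕ} (hp : 1 ≤ p)
    (h : ∀ k ∈ Finset.Icc 1 p, A k = A' k ∧ B k = B' k ∧ C k = C' k ∧ D k = D' k) :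
    limitMoment A B C D p = limitMoment A' B' C' D' p := by
  induction p using Nat.strong_induction_on with
  | _ p ih =>
    obtain ⟨hA, hB, hC, hD⟩ := h p (Finset.mem_Icc.2 ⟨hp, le_rfl⟩)
    rw [limitMoment_eq _ _ _ _ hp, limitMoment_eq _ _ _ _ hp, hA, hB, hC, hD]
    congr 2
    refine Finset.sum_congr rfl fun k hk => ?_
    rw [Finset.mem_Icc] at hk
    obtain ⟨hA, hB, -, -⟩ := h k (Finset.mem_Icc.2 ⟨hk.1, by omega⟩)
    obtain ⟨-, -, hC, hD⟩ := h (p - k) (Finset.mem_Icc.2 ⟨by omega, by omega⟩)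
    rw [hA, hB, hC, hD, ih k (by omega) hk.1 fun l hl =>
      h l (Finset.mem_Icc.2 ⟨(Finset.mem_Icc.1 hl).1, by have := (Finset.mem_Icc.1 hl).2; omega⟩)]

/-- The algebraic core: the binomial theorem for both children, with constants subtracted and added
back. It holds for arbitrary `A B C D`; taking the moments makes the last two averages centred. -/
lemma IsBifurcating.genAvg_pow_succ {Ω : Type*} {x : ℝ} {α e β f Y : ℕ → Ω → ℝ}
    (hY : IsBifurcating x α e β f Y) (A B C D : ℕ → ℝ) (q n : ℕ) (ω : Ω) :
    genAvg (fun k => Y k ω ^ q) (n + 1) =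
      ∑ j ∈ Finset.range (q + 1), (1 / 2 : ℝ) * (q.choose j : ℝ) *
        ((A j * C (q - j) + B j * D (q - j)) * genAvg (fun k => Y k ω ^ j) n +
          (genAvg (fun k => Y k ω ^ j * (α k ω ^ j * e k ω ^ (q - j) - A j * C (q - j))) n +
            genAvg (fun k => Y k ω ^ j * (β k ω ^ j * f k ω ^ (q - j) - B j * D (q - j))) n)) := by
  simp only [← genAvg_add, ← genAvg_const_mul, ← genAvg_finset_sum]
  rw [genAvg_succ, div_eq_inv_mul, ← genAvg_const_mul]
  refine genAvg_congr (fun k hk => ?_) n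
  rw [hY.even_child k hk, hY.odd_child k hk, add_pow, add_pow, ← Finset.sum_add_distrib,
    Finset.mul_sum]
  refine Finset.sum_congr rfl fun j _ => ?_
  rw [mul_pow, mul_pow]
  ring

namespace IsBifurcating

variable {Ω : Type*} [mΩ : MeasurableSpace Ω] {μ : Measure Ω} {m : ℕ → MeasurableSpace Ω}
  {α e β f Y : ℕ → Ω → ℝ} {A B C D : ℕ → ℝ} {x : ℝ}

lemma ae_tendsto_genAvg_pow [IsProbabilityMeasure μ] (hY : IsBifurcating x α e β f Y)
    (h : IsBranch μ m α e A C) (h' : IsBranch μ m β f B D) (hm : ∀ i, m i ≤ mΩ)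
    (hind : iIndep m μ) {p : ℕ} (hp : p ≤ 8) :
    ∀ᵐ ω ∂μ, Tendsto (genAvg fun k => Y k ω ^ p) atTop (𝓝 (limitMoment A B C D p)) := by
  obtain ⟨T, hT⟩ := hY.exists_moment_bound h h' hm hind
  have hYm := hY.measurable_pastSigma h h'
  have hYi : ∀ k, 1 ≤ k → Integrable (fun ω => Y k ω ^ 16) μ := fun k hk => (hT k hk).1
  have hYT : ∀ k, 1 ≤ k → ∫ ω, Y k ω ^ 16 ∂μ ≤ T := fun k hk => (hT k hk).2
  have hnoise : ∀ᵐ ω ∂μ, ∀ j l : ℕ, j ≤ 8 → l ≤ 8 →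
      Tendsto (genAvg fun k => Y k ω ^ j * (α k ω ^ j * e k ω ^ l - A j * C l)) atTop (𝓝 0) := by
    simp only [ae_all_iff]
    exact fun j l hj hl => h.ae_tendsto_genAvg_centred hm hind hYm hYi hYT hj hj hl
  have hnoise' : ∀ᵐ ω ∂μ, ∀ j l : ℕ, j ≤ 8 → l ≤ 8 →
      Tendsto (genAvg fun k => Y k ω ^ j * (β k ω ^ j * f k ω ^ l - B j * D l)) atTop (𝓝 0) := by
    simp only [ae_all_iff]
    exact fun j l hj hl => h'.ae_tendsto_genAvg_centred hm hind hYm hYi hYT hj hj hl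
  -- One event of full measure serves all exponents, so the induction on `p` is deterministic.
  filter_upwards [hnoise, hnoise'] with ω hω hω'
  induction p using Nat.strong_induction_on with
  | _ p ih =>
  rcases Nat.eq_zero_or_pos p with rfl | hp0
  · simp only [pow_zero, limitMoment]
    rw [show genAvg (fun _ => 1) = fun _ => 1 from funext genAvg_one]
    exact tendsto_const_nhds
  have hA := h.abs_coeff_moment_lt_one hp0 (by omega : p ≤ 16)
  have hB := h'.abs_coeff_moment_lt_one hp0 (by omega : p ≤ 16)
  rw [abs_lt] at hA hB
  have hθ : |(A p + B p) / 2| < 1 := abs_lt.2 ⟨by linarith, by linarith⟩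
  have hN : ∀ j ≤ p, Tendsto (fun n =>
      genAvg (fun k => Y k ω ^ j * (α k ω ^ j * e k ω ^ (p - j) - A j * C (p - j))) n +
        genAvg (fun k => Y k ω ^ j * (β k ω ^ j * f k ω ^ (p - j) - B j * D (p - j))) n)
      atTop (𝓝 0) := fun j hj => by
    simpa using (hω j (p - j) (by omega) (by omega)).add (hω' j (p - j) (by omega) (by omega))
  have hlim := tendsto_of_affine_recursion hθ
    (u := genAvg fun k => Y k ω ^ p)
    -- The term `j = p` is split off; as `C 0 = D 0 = 1`, its coefficient is `(A p + B p) / 2`.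
    (fun n => by
      rw [hY.genAvg_pow_succ A B C D p n ω, Finset.sum_range_succ, Nat.sub_self,
        h.noise_moment_zero, h'.noise_moment_zero, Nat.choose_self, Nat.cast_one, mul_one,
        mul_one, mul_one, mul_add (1 / 2 : ℝ), ← mul_assoc, add_comm, add_assoc,
        one_div, inv_mul_eq_div])
    (((hN p le_rfl).const_mul 2⁻¹).add (tendsto_finsetSum (Finset.range p) fun j hj =>
      (((ih j (Finset.mem_range.1 hj) (by have := Finset.mem_range.1 hj; omega)).const_mul
        (A j * C (p - j) + B j * D (p - j))).add
          (hN j (Finset.mem_range.1 hj).le)).const_mul (2⁻¹ * (p.choose j : ℝ))))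
  convert hlim using 2
  -- The term `j = 0` contributes `(C p + D p) / 2`, since `A 0 = B 0 = 1`.
  rw [limitMoment_eq _ _ _ _ hp0, Finset.range_eq_Ico, Finset.sum_eq_sum_Ico_succ_bot hp0,
    show Finset.Ico (0 + 1) p = Finset.Icc 1 (p - 1) by ext; simp; omega, limitMoment,
    h.coeff_moment_zero, h'.coeff_moment_zero]
  have h2 : 2 - (A p + B p) ≠ 0 := by linarith
  have h1 : 1 - (A p + B p) / 2 ≠ 0 := by linarith
  simp only [add_zero, mul_zero, zero_add, one_mul, mul_one, Nat.choose_zero_right, Nat.cast_one,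
    Nat.sub_zero, ← mul_assoc, one_div]
  field_simp
  ring

end IsBifurcating

/-- Empirical moments of a process with an arbitrary ancestor. -/
lemma ae_tendsto_genAvg_pow_of_recursion {Ω : Type*} [mΩ : MeasurableSpace Ω] {μ : Measure Ω}
    [IsProbabilityMeasure μ] {m : ℕ → MeasurableSpace Ω} {α e β f X : ℕ → Ω → ℝ}
    {A B C D : ℕ → ℝ}
    (heven : ∀ n, 1 ≤ n → ∀ ω, X (2 * n) ω = α n ω * X n ω + e n ω)
    (hodd : ∀ n, 1 ≤ n → ∀ ω, X (2 * n + 1) ω = β n ω * X n ω + f n ω)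
    (h : IsBranch μ m α e A C) (h' : IsBranch μ m β f B D) (hm : ∀ i, m i ≤ mΩ)
    (hind : iIndep m μ) {p : ℕ} (hp : p ≤ 8) :
    ∀ᵐ ω ∂μ, Tendsto (genAvg fun k => X k ω ^ p) atTop (𝓝 (limitMoment A B C D p)) := by
  obtain ⟨Y, hY⟩ : ∃ Y, IsBifurcating 0 α e β f Y := ⟨_, isBifurcating_bifProcess 0 α e β f⟩
  obtain ⟨P, hP⟩ : ∃ P, IsBifurcating 1 α (fun _ _ => 0) β (fun _ _ => 0) P :=
    ⟨_, isBifurcating_bifProcess 1 α _ β _⟩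
  have hX : ∀ k, 1 ≤ k → ∀ ω, X k ω = P k ω * X 1 ω + Y k ω := by
    refine binary_tree_induction (fun ω => ?_) (fun n hn ih ω => ?_) fun n hn ih ω => ?_
    · rw [hP.root, hY.root]; ring
    · rw [heven n hn, hP.even_child n hn, hY.even_child n hn, ih]; ring
    · rw [hodd n hn, hP.odd_child n hn, hY.odd_child n hn, ih]; ring
  have hsmall : ∀ᵐ ω ∂μ, ∀ i j : ℕ, i ≤ 8 → 1 ≤ j → j ≤ 8 →
      Tendsto (genAvg fun k => P k ω ^ j * Y k ω ^ i) atTop (𝓝 0) := by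
    simp only [ae_all_iff]
    exact fun i j hi hj0 hj => hY.ae_tendsto_genAvg_mul_noiseless hP h h' hm hind hi hj0 hj
  filter_upwards [hY.ae_tendsto_genAvg_pow h h' hm hind hp, hsmall] with ω hω hs
  -- Every term containing a positive power of `P` tends to zero, and the powers of `X 1 ω` are
  -- constants in the averages; only the average of `Y k ^ p` remains.
  have hexp : (genAvg fun k => X k ω ^ p) = fun n =>
      ∑ j ∈ Finset.range p, (X 1 ω ^ (j + 1) * (p.choose (j + 1) : ℝ)) *
        genAvg (fun k => P k ω ^ (j + 1) * Y k ω ^ (p - (j + 1))) n +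
          genAvg (fun k => Y k ω ^ p) n := by
    ext n
    simp only [← genAvg_const_mul, ← genAvg_finset_sum, ← genAvg_add]
    refine genAvg_congr (fun k hk => ?_) n
    rw [hX k hk, add_pow, Finset.sum_range_succ']
    simp only [pow_zero, Nat.sub_zero, one_mul, Nat.choose_zero_right, Nat.cast_one, mul_one]
    congr 1
    refine Finset.sum_congr rfl fun j _ => ?_
    rw [mul_pow]; ring
  rw [hexp]
  have := (tendsto_finsetSum (Finset.range p) fun j hj =>
    (hs (p - (j + 1)) (j + 1) (by omega) (by omega)
      (by have := Finset.mem_range.1 hj; omega)).const_mul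
        (X 1 ω ^ (j + 1) * (p.choose (j + 1) : ℝ))).add hω
  simpa using this

/-! ### Independence of the innovations -/

/-- Pairing two independent sequences of independent variables gives an independent sequence. -/
lemma iIndepFun_prodMk_of_indepFun {Ω E F : Type*} [MeasurableSpace Ω] [MeasurableSpace E]
    [MeasurableSpace F] {μ : Measure Ω} {U : ℕ → Ω → E} {V : ℕ → Ω → F}
    (hUm : ∀ n, Measurable (U n)) (hVm : ∀ n, Measurable (V n)) (hU : iIndepFun U μ)
    (hV : iIndepFun V μ) (hUV : IndepFun (fun ω n => U n ω) (fun ω n => V n ω) μ) :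
    iIndepFun (fun n ω => (U n ω, V n ω)) μ := by
  -- Independence of the two whole sequences, applied to cylinder sets.
  have hpair : ∀ (S : Finset ℕ) (s : ℕ → Set E) (t : ℕ → Set F),
      (∀ i ∈ S, MeasurableSet (s i)) → (∀ i ∈ S, MeasurableSet (t i)) →
        μ ((⋂ i ∈ S, U i ⁻¹' s i) ∩ ⋂ i ∈ S, V i ⁻¹' t i) =
          μ (⋂ i ∈ S, U i ⁻¹' s i) * μ (⋂ i ∈ S, V i ⁻¹' t i) := by
    intro S s t hs ht
    have := hUV.measure_inter_preimage_eq_mul (⋂ i ∈ S, (fun x : ℕ → E => x i) ⁻¹' s i)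
      (⋂ i ∈ S, (fun x : ℕ → F => x i) ⁻¹' t i)
      (S.measurableSet_biInter fun i hi => measurable_pi_apply i (hs i hi))
      (S.measurableSet_biInter fun i hi => measurable_pi_apply i (ht i hi))
    simpa only [Set.preimage_iInter, ← Set.preimage_comp, Function.comp_def] using this
  rw [iIndepFun_iff_iIndep]
  -- Preimages of measurable rectangles form a π-system generating the sigma-algebra of each pair,
  -- so independence is only checked on them.
  refine iIndepSets.iIndep (fun n => ((hUm n).prodMk (hVm n)).comap_le)
    (fun n => Set.preimage (fun ω => (U n ω, V n ω)) ''
      Set.image2 (· ×ˢ ·) {s : Set E | MeasurableSet s} {t : Set F | MeasurableSet t})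
    (fun n => ?_) (fun n => ?_) ?_
  · have := (isPiSystem_prod (α := E) (β := F)).comap fun ω => (U n ω, V n ω)
    convert this using 1
    ext s
    simp [Set.image, eq_comm]
  · rw [← generateFrom_prod, MeasurableSpace.comap_generateFrom]
  · rw [iIndepSets_iff]
    intro S g hg
    have : ∀ i, ∃ s : Set E, ∃ t : Set F, i ∈ S → MeasurableSet s ∧ MeasurableSet t ∧
        g i = U i ⁻¹' s ∩ V i ⁻¹' t := by
      intro i
      by_cases hi : i ∈ S
      · obtain ⟨_, ⟨s, hs, t, ht, rfl⟩, he⟩ := hg i hi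
        exact ⟨s, t, fun _ => ⟨hs, ht, he.symm⟩⟩
      · exact ⟨∅, ∅, fun h => absurd h hi⟩
    choose s t hst using this
    have hs : ∀ i ∈ S, MeasurableSet (s i) := fun i hi => (hst i hi).1
    have ht : ∀ i ∈ S, MeasurableSet (t i) := fun i hi => (hst i hi).2.1
    have hgi : ∀ i ∈ S, μ (g i) = μ (U i ⁻¹' s i) * μ (V i ⁻¹' t i) := fun i hi => by
      rw [(hst i hi).2.2]
      simpa using hpair {i} s t (by simpa using hs i hi) (by simpa using ht i hi)
    have hinter : ⋂ i ∈ S, g i = (⋂ i ∈ S, U i ⁻¹' s i) ∩ ⋂ i ∈ S, V i ⁻¹' t i := by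
      rw [Set.iInter₂_congr fun i hi => (hst i hi).2.2]
      ext ω
      simp only [Set.mem_iInter, Set.mem_inter_iff]
      exact ⟨fun h => ⟨fun i hi => (h i hi).1, fun i hi => (h i hi).2⟩,
        fun h i hi => ⟨h.1 i hi, h.2 i hi⟩⟩
    rw [hinter, hpair S s t hs ht, hU.measure_inter_preimage_eq_mul S hs,
      hV.measure_inter_preimage_eq_mul S ht, Finset.prod_congr rfl hgi, Finset.prod_mul_distrib]

/-- The innovation of the individual `n + 1`. -/
def innovation {Ω : Type*} (a b ε : ℕ → Ω → ℝ) (n : ℕ) (ω : Ω) : (ℝ × ℝ) × (ℝ × ℝ) :=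
  ((a (n + 1) ω, b (n + 1) ω), (ε (2 * (n + 1)) ω, ε (2 * (n + 1) + 1) ω))

/-- The sigma-algebra generated by the innovation of the individual `n + 1`. -/
@[reducible] def innovationSigma {Ω : Type*} (a b ε : ℕ → Ω → ℝ) (n : ℕ) : MeasurableSpace Ω :=
  MeasurableSpace.comap (innovation a b ε n) inferInstance

lemma measurable_innovationSigma_comp {Ω : Type*} {a b ε : ℕ → Ω → ℝ} {n : ℕ} (hn : 1 ≤ n) {φ : (ℝ × ℝ) × (ℝ × ℝ) → ℝ}
    (hφ : Measurable φ) :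
    Measurable[innovationSigma a b ε (n - 1)]
      fun ω => φ ((a n ω, b n ω), (ε (2 * n) ω, ε (2 * n + 1) ω)) := by
  obtain ⟨n, rfl⟩ := Nat.exists_eq_add_of_le' hn
  exact hφ.comp (comap_measurable (innovation a b ε n))

/-! ### The RCBAR process as two branches over independent innovations -/

namespace IsRCBAR

variable {Ω : Type*} [mΩ : MeasurableSpace Ω] {μ : Measure Ω} {X a b ε : ℕ → Ω → ℝ}

lemma measurable_coeff_pair (hX : IsRCBAR μ X a b ε) (n : ℕ) :
    Measurable fun ω => (a (n + 1) ω, b (n + 1) ω) :=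
  (hX.measurable_a _ (by omega)).prodMk (hX.measurable_b _ (by omega))

lemma measurable_noise_pair (hX : IsRCBAR μ X a b ε) (n : ℕ) :
    Measurable fun ω => (ε (2 * (n + 1)) ω, ε (2 * (n + 1) + 1) ω) :=
  (hX.measurable_noise _ (by omega)).prodMk (hX.measurable_noise _ (by omega))

lemma innovationSigma_le (hX : IsRCBAR μ X a b ε) (n : ℕ) : innovationSigma a b ε n ≤ mΩ :=
  ((hX.measurable_coeff_pair n).prodMk (hX.measurable_noise_pair n)).comap_le

lemma iIndep_innovationSigma (hX : IsRCBAR μ X a b ε) : iIndep (innovationSigma a b ε) μ :=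
  (iIndepFun_iff_iIndep _ _ _).1 (iIndepFun_prodMk_of_indepFun hX.measurable_coeff_pair
    hX.measurable_noise_pair hX.indep_coeff hX.indep_noise hX.indep_coeff_noise)

lemma indepFun_coeff_noise (hX : IsRCBAR μ X a b ε) {n : ℕ} (hn : 1 ≤ n) {φ ψ : ℝ × ℝ → ℝ}
    (hφ : Measurable φ) (hψ : Measurable ψ) :
    IndepFun (fun ω => φ (a n ω, b n ω)) (fun ω => ψ (ε (2 * n) ω, ε (2 * n + 1) ω)) μ := by
  obtain ⟨n, rfl⟩ := Nat.exists_eq_add_of_le' hn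
  exact hX.indep_coeff_noise.comp (hφ.comp (measurable_pi_apply n))
    (hψ.comp (measurable_pi_apply n))

lemma isBranch_even (hX : IsRCBAR μ X a b ε) (hH : HypH1 μ a b ε) :
    IsBranch μ (innovationSigma a b ε) a (fun n => ε (2 * n)) (fun k => moment (a 1) k μ)
      (fun k => moment (ε 2) k μ) where
  measurable_coeff n hn := measurable_innovationSigma_comp hn (φ := fun z => z.1.1) (by fun_prop)
  measurable_noise n hn := measurable_innovationSigma_comp hn (φ := fun z => z.2.1) (by fun_prop)
  indep n hn := hX.indepFun_coeff_noise hn measurable_fst measurable_fst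
  integrable_coeff n hn := (hH.coeff_a n hn).1
  integrable_noise n hn := (hH.noise_even.choose_spec n hn).1
  integral_coeff n hn i := ((hX.ident_coeff n hn).comp (measurable_fst.pow_const i)).integral_eq
  integral_noise n hn i := ((hX.ident_noise n hn).comp (measurable_fst.pow_const i)).integral_eq
  coeff_lt_one := (hH.coeff_a 1 le_rfl).2

lemma isBranch_odd (hX : IsRCBAR μ X a b ε) (hH : HypH1 μ a b ε) :
    IsBranch μ (innovationSigma a b ε) b (fun n => ε (2 * n + 1)) (fun k => moment (b 1) k μ)
      (fun k => moment (ε 3) k μ) where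
  measurable_coeff n hn := measurable_innovationSigma_comp hn (φ := fun z => z.1.2) (by fun_prop)
  measurable_noise n hn := measurable_innovationSigma_comp hn (φ := fun z => z.2.2) (by fun_prop)
  indep n hn := hX.indepFun_coeff_noise hn measurable_snd measurable_snd
  integrable_coeff n hn := (hH.coeff_b n hn).1
  integrable_noise n hn := (hH.noise_odd.choose_spec n hn).1
  integral_coeff n hn i := ((hX.ident_coeff n hn).comp (measurable_snd.pow_const i)).integral_eq
  integral_noise n hn i := ((hX.ident_noise n hn).comp (measurable_snd.pow_const i)).integral_eq
  coeff_lt_one := (hH.coeff_b 1 le_rfl).2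

end IsRCBAR

lemma moment_two_eq_variance_add_sq {Ω : Type*} [MeasurableSpace Ω] {μ : Measure Ω}
    [IsProbabilityMeasure μ] {Z : Ω → ℝ} (hZ : Measurable Z)
    (h : Integrable (fun ω => Z ω ^ 2) μ) : moment Z 2 μ = variance Z μ + μ[Z] ^ 2 := by
  rw [variance_eq_sub ((memLp_two_iff_integrable_sq hZ.aestronglyMeasurable).2 h), moment]
  ring

/-! ### The main theorem -/

theorem mainTheorem4 :
    -- `s p A B C D` is the limit, as a function of the sequences of moments of
    -- `a_1`, `b_1`, `ε_2`, `ε_3`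
    ∃ s : ℕ → (ℕ → ℝ) → (ℕ → ℝ) → (ℕ → ℝ) → (ℕ → ℝ) → ℝ,
      -- `s p` depends only on the moments up to order `p`
      (∀ p ∈ Finset.Icc 1 8, ∀ A B C D A' B' C' D' : ℕ → ℝ,
        (∀ k ∈ Finset.Icc 1 p, A k = A' k ∧ B k = B' k ∧ C k = C' k ∧ D k = D' k) →
          s p A B C D = s p A' B' C' D') ∧
      ∀ (Ω : Type*) [MeasurableSpace Ω] (μ : Measure Ω) [IsProbabilityMeasure μ]
        (X a b ε : ℕ → Ω → ℝ), IsRCBAR μ X a b ε → HypH1 μ a b ε →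
        ∀ (A B C D : ℕ → ℝ),
          (∀ k, A k = moment (a 1) k μ) → (∀ k, B k = moment (b 1) k μ) →
          (∀ k, C k = moment (ε 2) k μ) → (∀ k, D k = moment (ε 3) k μ) →
          -- the moments involved are finite and the denominators below are positive
          (∀ p ∈ Finset.Icc 1 8,
            Integrable (a 1 ^ p) μ ∧ Integrable (b 1 ^ p) μ ∧
            Integrable (ε 2 ^ p) μ ∧ Integrable (ε 3 ^ p) μ ∧ 0 < 2 - (A p + B p)) ∧
          -- almost sure convergence
          (∀ p ∈ Finset.Icc 1 8, ∀ᵐ ω ∂μ,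
            Tendsto (fun n : ℕ => empiricalMoment X p n ω) atTop (𝓝 (s p A B C D))) ∧
          -- explicit values of `s 1` and `s 2`
          s 1 A B C D = (μ[ε 2] + μ[ε 3]) / (2 - (μ[a 1] + μ[b 1])) ∧
          s 2 A B C D =
            2 / (2 - (variance (a 1) μ + variance (b 1) μ + μ[a 1] ^ 2 + μ[b 1] ^ 2)) *
              ((μ[a 1] * μ[ε 2] + μ[b 1] * μ[ε 3]) * (μ[ε 2] + μ[ε 3]) /
                  (2 - (μ[a 1] + μ[b 1])) +
                (variance (ε 2) μ + variance (ε 3) μ + μ[ε 2] ^ 2 + μ[ε 3] ^ 2) / 2) ∧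
          -- linear recursion
          (∀ p ∈ Finset.Icc 1 8,
            s p A B C D =
              2 / (2 - (A p + B p)) *
                (∑ k ∈ Finset.Icc 1 (p - 1),
                    (1 / 2 : ℝ) * (p.choose k : ℝ) *
                      (A k * C (p - k) + B k * D (p - k)) * s k A B C D +
                  (C p + D p) / 2)) := by
  refine ⟨fun p A B C D => limitMoment A B C D p, fun p hp A B C D A' B' C' D' h =>
    limitMoment_congr (Finset.mem_Icc.1 hp).1 h, ?_⟩
  intro Ω _ μ _ X a b ε hX hH A B C D hA hB hC hD
  have hm := hX.innovationSigma_le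
  have hev := hX.isBranch_even hH
  have hod := hX.isBranch_odd hH
  rw [← funext hA, ← funext hC] at hev
  rw [← funext hB, ← funext hD] at hod
  have hA1 : A 1 = μ[a 1] := by rw [hA, moment_one]
  have hB1 : B 1 = μ[b 1] := by rw [hB, moment_one]
  have hC1 : C 1 = μ[ε 2] := by rw [hC, moment_one]
  have hD1 : D 1 = μ[ε 3] := by rw [hD, moment_one]
  have hlt : ∀ p, 1 ≤ p → p ≤ 8 → 0 < 2 - (A p + B p) := fun p h1 h8 => by
    have := (abs_lt.1 (hev.abs_coeff_moment_lt_one h1 (by omega))).2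
    have := (abs_lt.1 (hod.abs_coeff_moment_lt_one h1 (by omega))).2
    linarith
  have hone : limitMoment A B C D 1 = (C 1 + D 1) / (2 - (A 1 + B 1)) := by
    rw [limitMoment_eq _ _ _ _ le_rfl]
    have := (hlt 1 le_rfl (by norm_num)).ne'
    simp only [Nat.sub_self, Finset.Icc_eq_empty_of_lt zero_lt_one, Finset.sum_empty,
      zero_add]
    field_simp
  refine ⟨fun p hp => ?_, fun p hp => ?_, ?_, ?_, fun p hp => ?_⟩
  · obtain ⟨h1, h8⟩ := Finset.mem_Icc.1 hp
    exact ⟨hev.integrable_coeff_pow hm le_rfl (by omega),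
      hod.integrable_coeff_pow hm le_rfl (by omega),
      hev.integrable_noise_pow hm le_rfl (by omega),
      hod.integrable_noise_pow hm le_rfl (by omega), hlt p h1 h8⟩
  · filter_upwards [ae_tendsto_genAvg_pow_of_recursion hX.even_child hX.odd_child hev hod hm
      hX.iIndep_innovationSigma (Finset.mem_Icc.1 hp).2] with ω hω
    exact tendsto_treeAvg hω
  · change limitMoment A B C D 1 = _
    rw [hone, hA1, hB1, hC1, hD1]
  · have h2a := moment_two_eq_variance_add_sq (hX.measurable_a 1 le_rfl)
      (hev.integrable_coeff_pow hm le_rfl (by norm_num))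
    have h2b := moment_two_eq_variance_add_sq (hX.measurable_b 1 le_rfl)
      (hod.integrable_coeff_pow hm le_rfl (by norm_num))
    have h2c := moment_two_eq_variance_add_sq (hX.measurable_noise 2 le_rfl)
      (hev.integrable_noise_pow hm le_rfl (by norm_num))
    have h2d := moment_two_eq_variance_add_sq (hX.measurable_noise 3 (by norm_num))
      (hod.integrable_noise_pow hm le_rfl (by norm_num))
    change limitMoment A B C D 2 = _
    -- The recursion has the single summand `k = 1`, with coefficient `1 / 2 * 2 = 1`; second
    -- moments then become variance plus squared mean.
    rw [limitMoment_eq _ _ _ _ one_le_two]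
    simp only [Nat.reduceSub, Finset.Icc_self, Finset.sum_singleton, Nat.choose_one_right]
    rw [hone, ← hA1, ← hB1, ← hC1, ← hD1, hA 2, hB 2, hC 2, hD 2, h2a, h2b, h2c, h2d, hA1, hB1,
      hC1, hD1]
    congr 1
    · congr 1; ring
    · push_cast; ring
  · exact limitMoment_eq _ _ _ _ (Finset.mem_Icc.1 hp).1
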